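/- **Theorem 3.4 (Trotter error with commutator scaling).** Let $p\ge 0$ and $\Upsilon\ge 1$ be integers. There is a constant $C>0$, depending only on $p$ and $\Upsilon$, such that the following holds. Let $H_1,\dots,H_\Gamma$ be complex $d\times d$ matrices, $H=\sum_{\gamma=1}^{\Gamma}H_\gamma$, and let $$\mathscr S(t)=\prod_{\upsilon=1}^{\Upsilon}\prod_{\gamma=1}^{\Gamma}e^{t\,a_{(\upsilon,\gamma)}H_{\pi_\upsilon(\gamma)}}$$ (products ordered with indices increasing from right to left) be an $\Upsilon$-stage product formula, where the $a_{(\upsilon,\gamma)}$ are real numbers with $|a_{(\upsilon,\gamma)}|\le 1$ and each $\pi_\upsilon$ is a permutation of $\{1,\dots,\Gamma\}$. Suppose that the formula is of order $p$, that is, $\mathscr S(t)=e^{tH}+O(t^{p+1})$ as $t\to 0$ (the implied constant and the range of $t$ here may depend on all the data). Define $$\tilde\alpha_{\mathrm{comm}}=\sum_{\gamma_1,\dots,\gamma_{p+1}=1}^{\Gamma}\big\|[H_{\gamma_{p+1}},\cdots[H_{\gamma_2},H_{\gamma_1}]]\big\|,$$ where $\|\cdot\|$ is the spectral norm, and define the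 additive error $\mathscr A(t)$ and the multiplicative error $\mathscr M(t)$ by $\mathscr S(t)=e^{tH}+\mathscr A(t)$ and $\mathscr S(t)=e^{tH}(I+\mathscr M(t))$. Then for all $t\ge 0$ $$\|\mathscr A(t)\|\le C\,\tilde\alpha_{\mathrm{comm}}\,t^{p+1}e^{2t\Upsilon\sum_{\gamma=1}^{\Gamma}\|H_\gamma\|},\qquad \|\mathscr M(t)\|\le C\,\tilde\alpha_{\mathrm{comm}}\,t^{p+1}e^{2t\Upsilon\sum_{\gamma=1}^{\Gamma}\|H_\gamma\|}.$$ If moreover every $H_\gamma$ is anti-Hermitian, then for all $t\ge 0$ $$\|\mathscr A(t)\|\le C\,\tilde\alpha_{\mathrm{comm}}\,t^{p+1},\qquad \|\mathscr M(t)\|\le C\,\tilde\alpha_{\mathrm{comm}}\,t^{p+1}.$$ -/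

import Mathlib

open scoped Matrix Matrix.Norms.L2Operator

noncomputable section

namespace Trotter

/-- Square complex matrices of size `d`, i.e. the operators on a `d`-dimensional Hilbert space.
The norm in force on them is the spectral norm (operator norm with respect to the Euclidean
norm), through the scope `Matrix.Norms.L2Operator` opened above. -/
abbrev Op (d : ℕ) : Type := Matrix (Fin d) (Fin d) ℂ

/-- Ordered product with the indices increasing from right to left:
`f (n - 1) * ⋯ * f 1 * f 0`. -/
def leftProd {d n : ℕ} (f : Fin n → Op d) : Op d :=
  (List.ofFn f).reverse.prod

/-- The operator `H = ∑ γ, H γ`. -/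
def total {d Γ : ℕ} (H : Fin Γ → Op d) : Op d :=
  ∑ γ, H γ

/-- The ideal evolution `e^{tH}`, `H = ∑ γ, H γ`. -/
def evolution {d Γ : ℕ} (H : Fin Γ → Op d) (t : ℝ) : Op d :=
  NormedSpace.exp (t • total H)

/-- The `Υ`-stage product formula with coefficients `a υ γ` and with the ordering of the
summands in stage `υ` given by the permutation `π υ`. -/
def productFormula {d Γ Υ : ℕ} (a : Fin Υ → Fin Γ → ℝ) (π : Fin Υ → Equiv.Perm (Fin Γ))
    (H : Fin Γ → Op d) (t : ℝ) : Op d :=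
  leftProd fun υ => leftProd fun γ => NormedSpace.exp ((t * a υ γ) • H (π υ γ))

/-- The product formula is of order `p` (for the given summands):
`S(t) = e^{tH} + O(t^{p+1})` as `t → 0`. -/
def IsOfOrder {d Γ Υ : ℕ} (p : ℕ) (a : Fin Υ → Fin Γ → ℝ) (π : Fin Υ → Equiv.Perm (Fin Γ))
    (H : Fin Γ → Op d) : Prop :=
  (fun t : ℝ => productFormula a π H t - evolution H t)
    =O[nhds (0 : ℝ)] fun t : ℝ => t ^ (p + 1)

/-- The additive error, `S(t) = e^{tH} + A(t)`. -/
def additiveError {d Γ Υ : ℕ} (a : Fin Υ → Fin Γ → ℝ) (π : Fin Υ → Equiv.Perm (Fin Γ))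
    (H : Fin Γ → Op d) (t : ℝ) : Op d :=
  productFormula a π H t - evolution H t

/-- The multiplicative error, `S(t) = e^{tH} (I + M(t))`. -/
def multiplicativeError {d Γ Υ : ℕ} (a : Fin Υ → Fin Γ → ℝ) (π : Fin Υ → Equiv.Perm (Fin Γ))
    (H : Fin Γ → Op d) (t : ℝ) : Op d :=
  evolution H (-t) * productFormula a π H t - 1

/-- The defining equation of the multiplicative error. It determines `multiplicativeError`
since `evolution H t` is invertible. -/
theorem productFormula_eq_mul {d Γ Υ : ℕ} (a : Fin Υ → Fin Γ → ℝ)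
    (π : Fin Υ → Equiv.Perm (Fin Γ)) (H : Fin Γ → Op d) (t : ℝ) :
    productFormula a π H t = evolution H t * (1 + multiplicativeError a π H t) := by
  have h : evolution H t * evolution H (-t) = 1 := by
    unfold evolution
    rw [← Matrix.exp_add_of_commute, neg_smul, add_neg_cancel, NormedSpace.exp_zero]
    exact ((Commute.refl (total H)).smul_left t).smul_right (-t)
  rw [multiplicativeError, add_sub_cancel, ← mul_assoc, h, one_mul]

/-- The right-nested commutator `[X p, [⋯, [X 1, X 0] ⋯]]`, with `p` commutators;
here `⁅A, B⁆ = A * B - B * A`. -/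
def nestedCommutator {d : ℕ} : (p : ℕ) → (Fin (p + 1) → Op d) → Op d
  | 0, X => X 0
  | p + 1, X => ⁅X (Fin.last (p + 1)), nestedCommutator p fun i => X i.castSucc⁆

/-- The sum of the spectral norms of all nested commutators of `p + 1` summands. -/
def alphaComm {d Γ : ℕ} (p : ℕ) (H : Fin Γ → Op d) : ℝ :=
  ∑ γ : Fin (p + 1) → Fin Γ, ‖nestedCommutator p fun i => H (γ i)‖

end Trotter

end

/-!
The product formula is a product `S(t) = e^{tAₙ} ⋯ e^{tA₁}` of exponentials, so `S' = R S` with the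
generator `R = ∑ₖ e^{tAₙ} ⋯ e^{tAₖ₊₁} Aₖ e^{-tAₖ₊₁} ⋯ e^{-tAₙ}`, and the additive error `𝒜 = S - e^{tH}`
solves `𝒜' = H 𝒜 + (R - H) S`. Each conjugation in `R` is expanded by Taylor's formula from the
innermost exponential outwards, stopping as soon as the total order reaches `p`
(`exists_taylor_orderedExp_mul`, `exists_taylor_orderedExpDeriv`). This writes `R` as a polynomial
in `t` of degree less than `p` plus a remainder made of conjugates of `p`-fold nested commutators.

The order condition says `𝒜 = O(t^{p+1})`. Since `𝒜` is analytic, `𝒜' = O(t^p)`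
(`deriv_isBigO_of_isBigO`), hence `(R - H) S = O(t^p)`, and the polynomial part of `R - H` vanishes
identically (`coeff_eq_zero_of_isBigO`). What is left is `t^p` times the nested commutators, and
Duhamel's principle (`norm_le_of_hasDerivAt_mul_add`) integrates this to `t^{p+1}`.

Only `R S` is ever estimated, never `R`: in a conjugate `U X U⁻¹` multiplied by `S` the factor `U⁻¹`
cancels against `S`, so the growth is that of one product of exponentials. Thus the additive error
grows like `e^{tΥ∑‖H_γ‖}`, and the factor `e^{-tH}` in the multiplicative error brings this to
`e^{2tΥ∑‖H_γ‖}`. In the anti-Hermitian case all exponentials are unitary and the same estimate holds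
without growth; the lemmas therefore carry a growth function `m` with `‖e^{sA}‖ ≤ e^{s m(A)}`.

Finally, each of the `Υ` stages contains every `H_γ` once, with a coefficient in `[-1, 1]`, so the
commutators that occur are bounded by `Υ^{p+1}` times the sum of all of them
(`sum_map_commSum_generators_le`). For `p = 0` there is no polynomial part and `H` itself, with
`‖H‖ ≤ ∑ ‖H_γ‖`, enters the remainder. Both cases give the constant `Υ^{p+1} + 1`.
-/

noncomputable section

namespace Trotter

open scoped Topology
open Filter Asymptotics Finset

/-! ### Sums of norms of nested commutators -/

section BanachAlgebra

variable {𝔸 : Type*} [NormedRing 𝔸]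

/-- The sum of the norms `‖⁅A_q, ⁅⋯, ⁅A₁, B⁆⋯⁆⁆‖` over all words `A₁ ⋯ A_q` of length `q` whose
letters are entries of `L`, counted with multiplicity. The recursion adds the innermost letter first. -/
def commSum (L : List 𝔸) : ℕ → 𝔸 → ℝ
  | 0, B => ‖B‖
  | q + 1, B => (L.map fun A => commSum L q ⁅A, B⁆).sum

theorem commSum_nonneg (L : List 𝔸) (q : ℕ) (B : 𝔸) : 0 ≤ commSum L q B := by
  induction q generalizing B with
  | zero => exact norm_nonneg B
  | succ q ih =>
    refine List.sum_nonneg fun x hx => ?_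
    obtain ⟨A, -, rfl⟩ := List.mem_map.1 hx
    exact ih _

theorem commSum_le_cons (A : 𝔸) (L : List 𝔸) (q : ℕ) (B : 𝔸) :
    commSum L q B ≤ commSum (A :: L) q B := by
  induction q generalizing B with
  | zero => exact le_rfl
  | succ q ih =>
    simp only [commSum, List.map_cons, List.sum_cons]
    have h := List.sum_le_sum (l := L) fun X _ => ih ⁅X, B⁆
    linarith [commSum_nonneg (A :: L) q ⁅A, B⁆]

/-- Words over `A :: L` include those that start, innermost, with a power of `A` and go on with
letters of `L`. -/
theorem sum_commSum_iterate_le (A : 𝔸) (L : List 𝔸) (q : ℕ) (B : 𝔸) :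
    ∑ i ∈ range (q + 1), commSum L (q - i) ((fun X => ⁅A, X⁆)^[i] B) ≤ commSum (A :: L) q B := by
  induction q generalizing B with
  | zero => simp [commSum]
  | succ q ih =>
    rw [sum_range_succ']
    have h1 := ih ⁅A, B⁆
    have h2 := List.sum_le_sum (l := L) fun X _ => commSum_le_cons A L q ⁅X, B⁆
    simp only [Nat.add_sub_add_right, Function.iterate_succ, Function.comp_apply, Nat.sub_zero,
      Function.iterate_zero, id, commSum, List.map_cons, List.sum_cons] at h1 ⊢
    exact add_le_add h1 h2

variable [NormedAlgebra ℝ 𝔸]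

theorem commSum_smul (L : List 𝔸) (q : ℕ) (a : ℝ) (B : 𝔸) :
    commSum L q (a • B) = |a| * commSum L q B := by
  induction q generalizing B with
  | zero => simp [commSum, norm_smul]
  | succ q ih =>
    have h : ∀ A : 𝔸, ⁅A, a • B⁆ = a • ⁅A, B⁆ := fun A => by
      simp only [Ring.lie_def, mul_smul_comm, smul_mul_assoc, smul_sub]
    simp only [commSum, h, ih, List.sum_map_mul_left]

/-! ### Polynomials and analytic functions of given order at zero -/

/-- A polynomial of degree less than `p` that is `O(t^p)` at `0⁺` is zero; the factor `U`, which
tends to `1`, is harmless. -/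
theorem coeff_eq_zero_of_isBigO {p : ℕ} {c : ℕ → 𝔸} {U : ℝ → 𝔸}
    (hU : Tendsto U (𝓝[>] 0) (𝓝 1))
    (h : (fun t : ℝ => (∑ j ∈ range p, t ^ j • c j) * U t) =O[𝓝[>] 0] fun t : ℝ => t ^ p) :
    ∀ j < p, c j = 0 := by
  induction p generalizing c with
  | zero => simp
  | succ p ih =>
    have hid : Tendsto (fun t : ℝ => t) (𝓝[>] 0) (𝓝 0) :=
      tendsto_nhdsWithin_of_tendsto_nhds tendsto_id
    have hlim : Tendsto (fun t : ℝ => (∑ j ∈ range (p + 1), t ^ j • c j) * U t) (𝓝[>] 0)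
        (𝓝 (c 0)) := by
      have h1 : Tendsto (fun t : ℝ => ∑ j ∈ range (p + 1), t ^ j • c j) (𝓝[>] 0)
          (𝓝 (∑ j ∈ range (p + 1), (0 : ℝ) ^ j • c j)) :=
        tendsto_finsetSum _ fun j _ => (hid.pow j).smul_const (c j)
      simpa [sum_range_succ'] using h1.mul hU
    have hlim0 : Tendsto (fun t : ℝ => t ^ (p + 1)) (𝓝[>] 0) (𝓝 0) := by
      simpa using hid.pow (p + 1)
    have hc0 : c 0 = 0 := tendsto_nhds_unique hlim (h.trans_tendsto hlim0)
    have hdiv : (fun t : ℝ => (∑ j ∈ range p, t ^ j • c (j + 1)) * U t) =O[𝓝[>] 0]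
        fun t : ℝ => t ^ p := by
      refine ((isBigO_refl (fun t : ℝ => t⁻¹) (𝓝[>] 0)).smul h).congr' ?_ ?_
      · filter_upwards [self_mem_nhdsWithin] with t ht
        have ht : t ≠ 0 := ne_of_gt ht
        simp only [sum_range_succ', hc0, smul_zero, add_zero, pow_succ', mul_smul, ← smul_sum,
          smul_mul_assoc, inv_smul_smul₀ ht]
      · filter_upwards [self_mem_nhdsWithin] with t ht
        have ht : t ≠ 0 := ne_of_gt ht
        simp only [smul_eq_mul, pow_succ']
        field_simp
    intro j hj
    obtain _ | j := j
    · exact hc0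
    · exact ih hdiv j (by omega)

/-- An `O`-estimate by a power may be differentiated for an analytic function, because it bounds the
order of vanishing from below. -/
theorem deriv_isBigO_of_isBigO [CompleteSpace 𝔸] {f : ℝ → 𝔸} (hf : AnalyticAt ℝ f 0) {p : ℕ}
    (h : f =O[𝓝 0] fun t : ℝ => t ^ (p + 1)) : deriv f =O[𝓝 0] fun t : ℝ => t ^ p := by
  have hf0 : f 0 = 0 := by
    have h1 : Tendsto (fun t : ℝ => t ^ (p + 1)) (𝓝 0) (𝓝 0) := by
      simpa using (tendsto_id (x := 𝓝 (0 : ℝ))).pow (p + 1)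
    exact tendsto_nhds_unique hf.continuousAt (h.trans_tendsto h1)
  have hord : (p : ℕ∞) + 1 ≤ analyticOrderAt f 0 := by
    by_contra hlt
    rw [not_le] at hlt
    -- write `f = t ^ n • g` with `n ≤ p` and `g 0 ≠ 0`; then `g` tends to `0`
    obtain ⟨n, hn⟩ := ENat.ne_top_iff_exists.1 (ne_top_of_lt hlt)
    obtain ⟨g, hg, hg0, hfg⟩ := hf.analyticOrderAt_eq_natCast.1 hn.symm
    have hnp : n < p + 1 := by rw [← hn] at hlt; exact_mod_cast hlt
    have hg' : g =O[𝓝[≠] 0] fun t : ℝ => t ^ (p + 1 - n) := by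
      refine ((isBigO_refl (fun t : ℝ => (t ^ n)⁻¹) (𝓝[≠] 0)).smul
        (h.mono nhdsWithin_le_nhds)).congr' ?_ ?_
      · filter_upwards [self_mem_nhdsWithin, hfg.filter_mono nhdsWithin_le_nhds] with t ht hft
        have ht : t ^ n ≠ 0 := pow_ne_zero _ ht
        rw [hft, sub_zero, inv_smul_smul₀ ht]
      · filter_upwards [self_mem_nhdsWithin] with t ht
        have ht : t ≠ 0 := ht
        rw [smul_eq_mul, pow_sub₀ _ ht hnp.le, mul_comm]
    have h1 : Tendsto (fun t : ℝ => t ^ (p + 1 - n)) (𝓝[≠] 0) (𝓝 0) := by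
      have := ((tendsto_id (x := 𝓝 (0 : ℝ))).pow (p + 1 - n)).mono_left
        (nhdsWithin_le_nhds (s := {0}ᶜ))
      simpa [zero_pow (Nat.sub_ne_zero_of_lt hnp)] using this
    exact hg0 (tendsto_nhds_unique (hg.continuousAt.tendsto.mono_left nhdsWithin_le_nhds)
      (hg'.trans_tendsto h1))
  obtain ⟨g, hg, hfg⟩ := (natCast_le_analyticOrderAt hf.deriv).1
    ((analyticOrderAt_deriv_ge_iff hf hf0).2 hord)
  have hgO : g =O[𝓝 0] fun _ => (1 : ℝ) := hg.continuousAt.tendsto.isBigO_one ℝ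
  refine ((isBigO_refl (fun t : ℝ => t ^ p) (𝓝 0)).smul hgO).congr' ?_ ?_
  · filter_upwards [hfg] with t ht
    rw [ht, sub_zero]
  · exact Eventually.of_forall fun t => by simp

/-! ### Ordered products of exponentials -/

/-- The product `e^{tAₙ} ⋯ e^{tA₁}` for the list `[A₁, …, Aₙ]`: the head of the list is the
rightmost factor. -/
def orderedExp : List 𝔸 → ℝ → 𝔸
  | [], _ => 1
  | A :: L, t => orderedExp L t * NormedSpace.exp (t • A)

/-- The derivative of `orderedExp L` at `t`, see `hasDerivAt_orderedExp`. -/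
def orderedExpDeriv : List 𝔸 → ℝ → 𝔸
  | [], _ => 0
  | A :: L, t => orderedExpDeriv L t * NormedSpace.exp (t • A) +
      orderedExp L t * (A * NormedSpace.exp (t • A))

theorem orderedExp_zero (L : List 𝔸) : orderedExp L 0 = 1 := by
  induction L with
  | nil => rfl
  | cons A L ih => simp [orderedExp, ih]

theorem norm_orderedExp_le [NormOneClass 𝔸] {m : 𝔸 → ℝ} {L : List 𝔸}
    (hL : ∀ A ∈ L, ∀ s, 0 ≤ s → ‖NormedSpace.exp (s • A)‖ ≤ Real.exp (s * m A)) {t : ℝ}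
    (ht : 0 ≤ t) : ‖orderedExp L t‖ ≤ Real.exp (t * (L.map m).sum) := by
  induction L with
  | nil => simp [orderedExp]
  | cons A L ih =>
    rw [List.forall_mem_cons] at hL
    rw [List.map_cons, List.sum_cons, mul_add, add_comm, Real.exp_add]
    exact norm_mul_le_of_le (ih hL.2) (hL.1 t ht)

theorem norm_exp_le_exp_norm [NormOneClass 𝔸] (A : 𝔸) : ‖NormedSpace.exp A‖ ≤ Real.exp ‖A‖ := by
  have h1 := NormedSpace.expSeries_div_hasSum_exp ‖A‖
  rw [← Real.exp_eq_exp_ℝ] at h1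
  rw [NormedSpace.exp_eq_tsum ℝ]
  refine tsum_of_norm_bounded h1 fun n => ?_
  rw [norm_smul, norm_inv, div_eq_inv_mul, RCLike.norm_natCast]
  gcongr
  exact norm_pow_le A n

variable [CompleteSpace 𝔸]

theorem hasDerivAt_orderedExp (L : List 𝔸) (t : ℝ) :
    HasDerivAt (orderedExp L) (orderedExpDeriv L t) t := by
  induction L with
  | nil => exact hasDerivAt_const t (1 : 𝔸)
  | cons A L ih => exact ih.mul (hasDerivAt_exp_smul_const' A t)

theorem analyticAt_exp_smul (A : 𝔸) (t : ℝ) :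
    AnalyticAt ℝ (fun s : ℝ => NormedSpace.exp (s • A)) t :=
  (NormedSpace.exp_analytic (𝕂 := ℝ) (t • A)).comp_of_eq
    (analyticAt_id.smul analyticAt_const) rfl

theorem analyticAt_orderedExp (L : List 𝔸) (t : ℝ) : AnalyticAt ℝ (orderedExp L) t := by
  induction L with
  | nil => exact analyticAt_const
  | cons A L ih => exact ih.mul (analyticAt_exp_smul A t)

/-! ### Duhamel's principle and Taylor expansions -/

/-- Duhamel's principle as an estimate. -/
theorem norm_le_of_hasDerivAt_mul_add {A : 𝔸} {F g : ℝ → 𝔸} {m M K : ℝ} {k : ℕ} (hK : 0 ≤ K)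
    (hmM : m ≤ M) (hA : ∀ s, 0 ≤ s → ‖NormedSpace.exp (s • A)‖ ≤ Real.exp (s * m))
    (h0 : F 0 = 0) (hF : ∀ t, HasDerivAt F (A * F t + g t) t)
    (hg : ∀ t, 0 ≤ t → ‖g t‖ ≤ K * t ^ k * Real.exp (t * M)) {t : ℝ} (ht : 0 ≤ t) :
    ‖F t‖ ≤ K * t ^ (k + 1) / (k + 1) * Real.exp (t * M) := by
  -- compare `τ ↦ e^{(t - τ)A} F(τ)` with the integral of the bound of its derivative
  have hE : ∀ τ, HasDerivAt (fun τ : ℝ => NormedSpace.exp ((t - τ) • A))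
      (-(NormedSpace.exp ((t - τ) • A) * A)) τ := fun τ => by
    convert! (hasDerivAt_exp_smul_const A (t - τ)).scomp τ ((hasDerivAt_id τ).const_sub t) using 1
    simp
  have hφ : ∀ τ, HasDerivAt (fun τ : ℝ => NormedSpace.exp ((t - τ) • A) * F τ)
      (NormedSpace.exp ((t - τ) • A) * g τ) τ := fun τ => by
    convert! (hE τ).mul (hF τ) using 1
    rw [mul_add, neg_mul, mul_assoc, neg_add_cancel_left]
  have hB : ∀ τ : ℝ, HasDerivAt (fun τ : ℝ => K * τ ^ (k + 1) / (k + 1) * Real.exp (t * M))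
      (K * τ ^ k * Real.exp (t * M)) τ := fun τ => by
    convert! (((hasDerivAt_pow (k + 1) τ).const_mul K).div_const ((k : ℝ) + 1)).mul_const
      (Real.exp (t * M)) using 1
    have : (k : ℝ) + 1 ≠ 0 := by positivity
    push_cast
    field_simp
  have := image_norm_le_of_norm_deriv_right_le_deriv_boundary (a := 0) (b := t)
    (fun τ _ => (hφ τ).continuousAt.continuousWithinAt) (fun τ _ => (hφ τ).hasDerivWithinAt)
    (by simp [h0]) hB (fun τ hτ => ?_) (Set.right_mem_Icc.2 ht)
  · simpa using this
  · calc ‖NormedSpace.exp ((t - τ) • A) * g τ‖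
        ≤ Real.exp ((t - τ) * m) * (K * τ ^ k * Real.exp (τ * M)) :=
          norm_mul_le_of_le (hA _ (by linarith [hτ.2])) (hg τ hτ.1)
      _ ≤ Real.exp ((t - τ) * M) * (K * τ ^ k * Real.exp (τ * M)) := by
          have h1 := hτ.1
          have : (t - τ) * m ≤ (t - τ) * M := mul_le_mul_of_nonneg_left hmM (by linarith [hτ.2])
          gcongr
      _ = K * τ ^ k * Real.exp (t * M) := by
          rw [show t * M = (t - τ) * M + τ * M by ring, Real.exp_add]
          ring

/-- Taylor expansion of `e^{tA} B e^{-tA}`, multiplied by `e^{tA}` from the right. Multiplied this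
way, the remainder costs a single growth factor `e^{tm}` of `e^{tA}`. -/
theorem norm_exp_mul_sub_taylor_le {A : 𝔸} {m : ℝ}
    (hA : ∀ s, 0 ≤ s → ‖NormedSpace.exp (s • A)‖ ≤ Real.exp (s * m)) (B : 𝔸) (q : ℕ) {t : ℝ}
    (ht : 0 ≤ t) :
    ‖NormedSpace.exp (t • A) * B - ∑ i ∈ range q,
        (t ^ i / (i.factorial : ℝ)) • ((fun X => ⁅A, X⁆)^[i] B * NormedSpace.exp (t • A))‖ ≤
      t ^ q * ‖(fun X => ⁅A, X⁆)^[q] B‖ * Real.exp (t * m) := by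
  obtain _ | k := q
  · simpa [mul_comm] using norm_mul_le_of_le (hA t ht) (le_refl ‖B‖)
  -- with `ad = ⁅A, ·⁆`, the remainder `F` solves `F' = A F + (tᵏ / k!) (adᵏ⁺¹ B) e^{tA}`
  have key : ∀ (k : ℕ) (t : ℝ), HasDerivAt
      (fun t : ℝ => NormedSpace.exp (t • A) * B - ∑ i ∈ range (k + 1),
        (t ^ i / (i.factorial : ℝ)) • ((fun X => ⁅A, X⁆)^[i] B * NormedSpace.exp (t • A)))
      (A * (NormedSpace.exp (t • A) * B - ∑ i ∈ range (k + 1),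
        (t ^ i / (i.factorial : ℝ)) • ((fun X => ⁅A, X⁆)^[i] B * NormedSpace.exp (t • A))) +
        (t ^ k / (k.factorial : ℝ)) •
          ((fun X => ⁅A, X⁆)^[k + 1] B * NormedSpace.exp (t • A))) t := by
    intro k t
    have hE := hasDerivAt_exp_smul_const' (𝕂 := ℝ) A t
    induction k with
    | zero =>
      simp only [zero_add, sum_range_one, pow_zero, Nat.factorial_zero, Nat.cast_one, div_one,
        one_smul, Function.iterate_zero, id, Function.iterate_one, Ring.lie_def]
      convert! (hE.mul_const B).sub (hE.const_mul B) using 1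
      noncomm_ring
    | succ k ih =>
      simp only [sum_range_succ _ (k + 1), ← sub_sub]
      have hp : HasDerivAt (fun t : ℝ => t ^ (k + 1) / ((k + 1).factorial : ℝ))
          (t ^ k / (k.factorial : ℝ)) t := by
        convert! (hasDerivAt_pow (k + 1) t).div_const ((k + 1).factorial : ℝ) using 1
        rw [Nat.factorial_succ]
        push_cast
        have : (k : ℝ) + 1 ≠ 0 := by positivity
        have : (k.factorial : ℝ) ≠ 0 := by positivity
        field_simp
      convert! ih.sub (hp.smul (hE.const_mul ((fun X => ⁅A, X⁆)^[k + 1] B))) using 1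
      rw [Function.iterate_succ_apply' _ (k + 1)]
      simp only [Ring.lie_def, sub_mul, mul_sub, smul_sub, mul_smul_comm, mul_assoc]
      abel
  have h := norm_le_of_hasDerivAt_mul_add (K := ‖(fun X => ⁅A, X⁆)^[k + 1] B‖) (k := k)
    (norm_nonneg _) le_rfl hA
    (by simp [sum_range_succ']) (key k) (fun s hs => ?_) ht
  · refine h.trans ?_
    gcongr ?_ * _
    rw [mul_comm]
    exact div_le_self (by positivity) (by linarith [Nat.cast_nonneg (α := ℝ) k])
  · rw [norm_smul, Real.norm_of_nonneg (by positivity)]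
    have h1 : s ^ k / (k.factorial : ℝ) ≤ s ^ k :=
      div_le_self (by positivity) (by exact_mod_cast Nat.succ_le_of_lt k.factorial_pos)
    calc _ ≤ s ^ k * (‖(fun X => ⁅A, X⁆)^[k + 1] B‖ * Real.exp (s * m)) :=
          mul_le_mul h1 (norm_mul_le_of_le le_rfl (hA s hs)) (norm_nonneg _) (by positivity)
      _ = _ := by ring

variable [NormOneClass 𝔸]

/-- Taylor expansion of order `q` of `S B S⁻¹`, `S = orderedExp L t`, multiplied by `S` from the
right. The exponentials are expanded from the innermost outwards, so that the remainder consists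
of conjugates of nested commutators. -/
theorem exists_taylor_orderedExp_mul {m : 𝔸 → ℝ} (L : List 𝔸)
    (hL : ∀ A ∈ L, ∀ s, 0 ≤ s → ‖NormedSpace.exp (s • A)‖ ≤ Real.exp (s * m A)) (q : ℕ) (B : 𝔸) :
    ∃ c : ℕ → 𝔸, ∀ t : ℝ, 0 ≤ t →
      ‖orderedExp L t * B - (∑ j ∈ range q, t ^ j • c j) * orderedExp L t‖ ≤
        t ^ q * commSum L q B * Real.exp (t * (L.map m).sum) := by
  induction L generalizing q B with
  | nil =>
    obtain _ | q := q
    · exact ⟨0, fun t _ => by simp [orderedExp, commSum]⟩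
    · exact ⟨Pi.single 0 B, fun t _ => by simp [orderedExp, commSum, sum_range_succ']⟩
  | cons A L ih =>
    rw [List.forall_mem_cons] at hL
    choose c hc using fun i => ih hL.2 (q - i) ((fun X => ⁅A, X⁆)^[i] B)
    refine ⟨fun n => ∑ i ∈ range (n + 1), (1 / (i.factorial : ℝ)) • c i (n - i), fun t ht => ?_⟩
    have hpoly : ∑ j ∈ range q, t ^ j • ∑ i ∈ range (j + 1), (1 / (i.factorial : ℝ)) • c i (j - i) =
        ∑ i ∈ range q, (t ^ i / (i.factorial : ℝ)) • ∑ j ∈ range (q - i), t ^ j • c i j := by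
      simp only [smul_sum]
      rw [← sum_range_diag_flip q
        fun i j => (t ^ i / (i.factorial : ℝ)) • t ^ j • c i j]
      refine sum_congr rfl fun n _ => sum_congr rfl fun i hi => ?_
      have hin : n = i + (n - i) := by have := mem_range.1 hi; omega
      rw [smul_smul, smul_smul]
      congr 1
      nth_rw 1 [hin]
      rw [pow_add]
      ring
    set E := NormedSpace.exp (t • A) with hE
    set S := orderedExp L t with hS
    have hEn : ‖E‖ ≤ Real.exp (t * m A) := hL.1 t ht
    have hSn : ‖S‖ ≤ Real.exp (t * (L.map m).sum) := norm_orderedExp_le hL.2 ht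
    -- expand the rightmost exponential `E` to order `q`, then `S` around each term of order `i` to
    -- order `q - i`
    have hsplit : S * E * B - (∑ i ∈ range q, (t ^ i / (i.factorial : ℝ)) •
          ∑ j ∈ range (q - i), t ^ j • c i j) * (S * E) =
        S * (E * B - ∑ i ∈ range q,
          (t ^ i / (i.factorial : ℝ)) • ((fun X => ⁅A, X⁆)^[i] B * E)) +
        ∑ i ∈ range q, (t ^ i / (i.factorial : ℝ)) •
          ((S * (fun X => ⁅A, X⁆)^[i] B - (∑ j ∈ range (q - i), t ^ j • c i j) * S) * E) := by
      simp only [mul_sub, sub_mul, smul_sub, sum_sub_distrib, mul_sum _ _ S, mul_smul_comm,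
        mul_assoc, sum_mul (range q), smul_mul_assoc]
      abel
    simp only [orderedExp, List.map_cons, List.sum_cons]
    rw [hpoly, ← hE, ← hS, hsplit]
    have hexp : Real.exp (t * (m A + (L.map m).sum)) =
        Real.exp (t * (L.map m).sum) * Real.exp (t * m A) := by
      rw [← Real.exp_add]; congr 1; ring
    have h1 := norm_mul_le_of_le hSn (norm_exp_mul_sub_taylor_le hL.1 B q ht)
    have h2 : ∀ i ∈ range q, ‖(t ^ i / (i.factorial : ℝ)) •
          ((S * (fun X => ⁅A, X⁆)^[i] B - (∑ j ∈ range (q - i), t ^ j • c i j) * S) * E)‖ ≤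
        t ^ q * commSum L (q - i) ((fun X => ⁅A, X⁆)^[i] B) *
          Real.exp (t * (m A + (L.map m).sum)) := by
      intro i hi
      rw [norm_smul, Real.norm_of_nonneg (by positivity)]
      have h3 : t ^ i / (i.factorial : ℝ) ≤ t ^ i :=
        div_le_self (by positivity) (by exact_mod_cast Nat.succ_le_of_lt i.factorial_pos)
      refine (mul_le_mul h3 (norm_mul_le_of_le (hc i t ht) hEn) (norm_nonneg _)
        (by positivity)).trans_eq ?_
      have hiq : t ^ q = t ^ i * t ^ (q - i) := by
        rw [← pow_add, Nat.add_sub_cancel' (mem_range.1 hi).le]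
      rw [hexp, hiq]
      ring
    calc _ ≤ _ := norm_add_le_of_le h1 (norm_sum_le_of_le _ h2)
      _ = t ^ q * (∑ i ∈ range (q + 1), commSum L (q - i) ((fun X => ⁅A, X⁆)^[i] B)) *
          Real.exp (t * (m A + (L.map m).sum)) := by
        rw [sum_range_succ, Nat.sub_self, hexp, ← sum_mul, ← mul_sum, commSum]
        ring
      _ ≤ _ := by
        gcongr
        exact sum_commSum_iterate_le A L q B

/-- Taylor expansion of the generator `S' S⁻¹`, `S = orderedExp L`, multiplied by `S` from the
right. -/
theorem exists_taylor_orderedExpDeriv {m : 𝔸 → ℝ} (L : List 𝔸)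
    (hL : ∀ A ∈ L, ∀ s, 0 ≤ s → ‖NormedSpace.exp (s • A)‖ ≤ Real.exp (s * m A)) (q : ℕ) :
    ∃ c : ℕ → 𝔸, ∀ t : ℝ, 0 ≤ t →
      ‖orderedExpDeriv L t - (∑ j ∈ range q, t ^ j • c j) * orderedExp L t‖ ≤
        t ^ q * (L.map (commSum L q)).sum * Real.exp (t * (L.map m).sum) := by
  induction L with
  | nil => exact ⟨0, fun t _ => by simp [orderedExpDeriv]⟩
  | cons A L ih =>
    rw [List.forall_mem_cons] at hL
    obtain ⟨c, hc⟩ := ih hL.2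
    obtain ⟨b, hb⟩ := exists_taylor_orderedExp_mul L hL.2 q A
    refine ⟨c + b, fun t ht => ?_⟩
    have hsplit : orderedExpDeriv (A :: L) t -
          (∑ j ∈ range q, t ^ j • (c + b) j) * orderedExp (A :: L) t =
        ((orderedExpDeriv L t - (∑ j ∈ range q, t ^ j • c j) * orderedExp L t) +
          (orderedExp L t * A - (∑ j ∈ range q, t ^ j • b j) * orderedExp L t)) *
          NormedSpace.exp (t • A) := by
      simp only [orderedExpDeriv, orderedExp, Pi.add_apply, smul_add, sum_add_distrib]
      noncomm_ring
    rw [hsplit]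
    refine (norm_mul_le_of_le (norm_add_le_of_le (hc t ht) (hb t ht)) (hL.1 t ht)).trans ?_
    have hsum : (L.map (commSum L q)).sum + commSum L q A ≤
        ((A :: L).map (commSum (A :: L) q)).sum := by
      rw [List.map_cons, List.sum_cons, add_comm]
      exact add_le_add (commSum_le_cons A L q A)
        (List.sum_le_sum fun X _ => commSum_le_cons A L q X)
    calc (t ^ q * (L.map (commSum L q)).sum * Real.exp (t * (L.map m).sum) +
          t ^ q * commSum L q A * Real.exp (t * (L.map m).sum)) * Real.exp (t * m A)
        = t ^ q * ((L.map (commSum L q)).sum + commSum L q A) *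
          Real.exp (t * ((A :: L).map m).sum) := by
            rw [List.map_cons, List.sum_cons, mul_add t, Real.exp_add]
            ring
      _ ≤ _ := by gcongr

/-- The difference of a product of exponentials and `e^{tH}` that agree up to `O(t^{p+1})`,
bounded by commutators. For `p = 0` the Taylor polynomial is empty, so that `H` is not absorbed by its
constant term and has to be counted in the remainder. -/
theorem norm_orderedExp_sub_exp_le {m : 𝔸 → ℝ} {L : List 𝔸}
    (hL : ∀ A ∈ L, ∀ s, 0 ≤ s → ‖NormedSpace.exp (s • A)‖ ≤ Real.exp (s * m A))
    {H : 𝔸} {μ M : ℝ} (hH : ∀ s, 0 ≤ s → ‖NormedSpace.exp (s • H)‖ ≤ Real.exp (s * μ))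
    (hμM : μ ≤ M) (hLM : (L.map m).sum ≤ M) {p : ℕ}
    (hO : (fun t : ℝ => orderedExp L t - NormedSpace.exp (t • H)) =O[𝓝 0]
      fun t : ℝ => t ^ (p + 1)) {t : ℝ} (ht : 0 ≤ t) :
    ‖orderedExp L t - NormedSpace.exp (t • H)‖ ≤
      ((L.map (commSum L p)).sum + if p = 0 then ‖H‖ else 0) * t ^ (p + 1) *
        Real.exp (t * M) := by
  set K := (L.map (commSum L p)).sum with hK
  have hK0 : 0 ≤ K := List.sum_nonneg fun x hx => by
    obtain ⟨A, -, rfl⟩ := List.mem_map.1 hx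
    exact commSum_nonneg L p A
  have hK0' : 0 ≤ K + if p = 0 then ‖H‖ else 0 := by positivity
  have hder : ∀ t : ℝ, HasDerivAt (fun t : ℝ => orderedExp L t - NormedSpace.exp (t • H))
      (H * (orderedExp L t - NormedSpace.exp (t • H)) +
        (orderedExpDeriv L t - H * orderedExp L t)) t := fun t => by
    convert! (hasDerivAt_orderedExp L t).sub (hasDerivAt_exp_smul_const' (𝕂 := ℝ) H t) using 1
    noncomm_ring
  have hSn : ∀ s, 0 ≤ s → ‖orderedExp L s‖ ≤ Real.exp (s * M) := fun s hs =>
    (norm_orderedExp_le hL hs).trans (by gcongr)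
  obtain ⟨c, hc⟩ := exists_taylor_orderedExpDeriv L hL p
  have hrem : ∀ s : ℝ, 0 ≤ s → ‖orderedExpDeriv L s - H * orderedExp L s‖ ≤
      (K + if p = 0 then ‖H‖ else 0) * s ^ p * Real.exp (s * M) := by
    obtain _ | p := p
    · intro s hs
      have h1 := hc s hs
      simp only [range_zero, sum_empty, zero_mul, sub_zero, pow_zero, one_mul, ← hK] at h1
      simp only [if_true, pow_zero, mul_one, add_mul]
      exact norm_sub_le_of_le (h1.trans (by gcongr)) (norm_mul_le_of_le le_rfl (hSn s hs))
    · -- coefficients of the Taylor polynomial of `S' S⁻¹ - H`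
      set b : ℕ → 𝔸 := fun j => c j - if j = 0 then H else 0 with hb
      have hsum : ∀ s : ℝ, ∑ j ∈ range (p + 1), s ^ j • b j =
          ∑ j ∈ range (p + 1), s ^ j • c j - H := fun s => by
        simp [hb, sum_range_succ', add_sub_assoc]
      have hbound : ∀ s : ℝ, 0 ≤ s → ‖orderedExpDeriv L s - H * orderedExp L s -
          (∑ j ∈ range (p + 1), s ^ j • b j) * orderedExp L s‖ ≤
          K * s ^ (p + 1) * Real.exp (s * M) := fun s hs => by
        have h1 : orderedExpDeriv L s - H * orderedExp L s -
            (∑ j ∈ range (p + 1), s ^ j • b j) * orderedExp L s =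
            orderedExpDeriv L s - (∑ j ∈ range (p + 1), s ^ j • c j) * orderedExp L s := by
          rw [hsum]; noncomm_ring
        rw [h1]
        calc _ ≤ _ := hc s hs
          _ = K * s ^ (p + 1) * Real.exp (s * (L.map m).sum) := by ring
          _ ≤ _ := by gcongr
      -- the order condition makes the whole Taylor polynomial vanish
      have hb0 : ∀ j < p + 1, b j = 0 := by
        have hgen : (fun s : ℝ => orderedExpDeriv L s - H * orderedExp L s) =O[𝓝 0]
            fun s : ℝ => s ^ (p + 1) := by
          have hd := deriv_isBigO_of_isBigO
            ((analyticAt_orderedExp L 0).sub (analyticAt_exp_smul H 0)) hO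
          have hpow : (fun t : ℝ => t ^ (p + 1 + 1)) =O[𝓝 0] fun t : ℝ => t ^ (p + 1) :=
            (isLittleO_pow_pow (by omega)).isBigO
          have hH' := ((hO.trans hpow).const_mul_left H)
          refine (hd.sub hH').congr_left fun s => ?_
          have h2 := (hder s).deriv
          change deriv (fun t : ℝ => orderedExp L t - NormedSpace.exp (t • H)) s - _ = _
          rw [h2]
          abel
        have hr : (fun s : ℝ => orderedExpDeriv L s - H * orderedExp L s -
            (∑ j ∈ range (p + 1), s ^ j • b j) * orderedExp L s) =O[𝓝[>] 0]
            fun s : ℝ => s ^ (p + 1) := by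
          have he : (fun s : ℝ => K * Real.exp (s * M)) =O[𝓝[>] 0] fun _ => (1 : ℝ) := by
            have : Continuous fun s : ℝ => K * Real.exp (s * M) := by fun_prop
            exact (this.tendsto 0).isBigO_one ℝ |>.mono nhdsWithin_le_nhds
          have he' := he.mul (isBigO_refl (fun s : ℝ => s ^ (p + 1)) (𝓝[>] 0))
          simp only [one_mul] at he'
          refine IsBigO.trans (IsBigO.of_bound 1 ?_) he'
          filter_upwards [self_mem_nhdsWithin] with s hs
          have hs : (0 : ℝ) < s := hs
          rw [one_mul, Real.norm_of_nonneg (by positivity)]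
          exact (hbound s hs.le).trans_eq (by ring)
        refine coeff_eq_zero_of_isBigO (U := orderedExp L) ?_
          (((hgen.mono nhdsWithin_le_nhds).sub hr).congr_left fun s => by abel)
        have h3 := (analyticAt_orderedExp L 0).continuousAt.tendsto
        rw [orderedExp_zero] at h3
        exact h3.mono_left nhdsWithin_le_nhds
      intro s hs
      have h4 := hbound s hs
      rw [sum_eq_zero fun j hj => by rw [hb0 j (mem_range.1 hj), smul_zero], zero_mul,
        sub_zero] at h4
      simpa using h4
  refine (norm_le_of_hasDerivAt_mul_add hK0' hμM hH (by simp [orderedExp_zero]) hder hrem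
    ht).trans ?_
  gcongr ?_ * _
  exact div_le_self (by positivity) (by linarith [Nat.cast_nonneg (α := ℝ) p])

end BanachAlgebra

/-! ### Product formulas -/

variable {d Γ Υ : ℕ}

/-- The generators of the product formula in the order in which they are applied. -/
def generators (a : Fin Υ → Fin Γ → ℝ) (π : Fin Υ → Equiv.Perm (Fin Γ)) (H : Fin Γ → Op d) :
    List (Op d) :=
  (List.ofFn fun υ => List.ofFn fun γ => a υ γ • H (π υ γ)).flatten

theorem orderedExp_eq_prod (L : List (Op d)) (t : ℝ) :
    orderedExp L t = (L.map fun A => NormedSpace.exp (t • A)).reverse.prod := by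
  induction L with
  | nil => rfl
  | cons A L ih => simp [orderedExp, ih]

theorem productFormula_eq_orderedExp (a : Fin Υ → Fin Γ → ℝ) (π : Fin Υ → Equiv.Perm (Fin Γ))
    (H : Fin Γ → Op d) (t : ℝ) : productFormula a π H t = orderedExp (generators a π H) t := by
  simp only [orderedExp_eq_prod, generators, productFormula, leftProd, List.map_flatten,
    List.reverse_flatten, List.prod_flatten, List.map_reverse, List.map_ofFn, Function.comp_def,
    smul_smul]

theorem forall_mem_generators {P : Op d → Prop} {a : Fin Υ → Fin Γ → ℝ}
    {π : Fin Υ → Equiv.Perm (Fin Γ)} {H : Fin Γ → Op d} (h : ∀ υ γ, P (a υ γ • H (π υ γ))) :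
    ∀ A ∈ generators a π H, P A := by
  intro A hA
  simp only [generators, List.mem_flatten, List.mem_ofFn] at hA
  obtain ⟨_, ⟨υ, rfl⟩, hA⟩ := hA
  obtain ⟨γ, rfl⟩ := (List.mem_ofFn' _ _).1 hA
  exact h υ γ

/-- Each stage runs through every summand once, with a coefficient of absolute value at most one. -/
theorem sum_map_generators_le {a : Fin Υ → Fin Γ → ℝ} (ha : ∀ υ γ, |a υ γ| ≤ 1)
    (π : Fin Υ → Equiv.Perm (Fin Γ)) (H : Fin Γ → Op d) {Φ : Op d → ℝ}
    (hΦ : ∀ (r : ℝ) X, |r| ≤ 1 → Φ (r • X) ≤ Φ X) :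
    ((generators a π H).map Φ).sum ≤ Υ * ∑ γ, Φ (H γ) := by
  simp only [generators, List.map_flatten, List.sum_flatten, List.map_ofFn, Function.comp_def,
    List.sum_ofFn]
  calc ∑ υ, ∑ γ, Φ (a υ γ • H (π υ γ)) ≤ ∑ υ, ∑ γ, Φ (H (π υ γ)) :=
        sum_le_sum fun υ _ => sum_le_sum fun γ _ => hΦ _ _ (ha υ γ)
    _ = ∑ _υ : Fin Υ, ∑ γ, Φ (H γ) :=
        sum_congr rfl fun υ _ => Equiv.sum_comp (π υ) fun γ => Φ (H γ)
    _ = Υ * ∑ γ, Φ (H γ) := by simp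

theorem commSum_smul_le (L : List (Op d)) (q : ℕ) {r : ℝ} (hr : |r| ≤ 1) (B : Op d) :
    commSum L q (r • B) ≤ commSum L q B := by
  rw [commSum_smul]
  exact mul_le_of_le_one_left (commSum_nonneg L q B) hr

/-- Replacing the generators by the summands costs one factor `Υ` per letter. -/
theorem commSum_generators_le {a : Fin Υ → Fin Γ → ℝ} (ha : ∀ υ γ, |a υ γ| ≤ 1)
    (π : Fin Υ → Equiv.Perm (Fin Γ)) (H : Fin Γ → Op d) (q : ℕ) (B : Op d) :
    commSum (generators a π H) q B ≤ (Υ : ℝ) ^ q * commSum (List.ofFn H) q B := by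
  induction q generalizing B with
  | zero => simp [commSum]
  | succ q ih =>
    have h : ∀ (r : ℝ) (X : Op d), |r| ≤ 1 →
        commSum (generators a π H) q ⁅r • X, B⁆ ≤ commSum (generators a π H) q ⁅X, B⁆ := by
      intro r X hr
      have : ⁅r • X, B⁆ = r • ⁅X, B⁆ := by
        simp only [Ring.lie_def, mul_smul_comm, smul_mul_assoc, smul_sub]
      rw [this]
      exact commSum_smul_le _ q hr _
    calc commSum (generators a π H) (q + 1) B
        ≤ Υ * ∑ γ, commSum (generators a π H) q ⁅H γ, B⁆ := sum_map_generators_le ha π H h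
      _ ≤ Υ * ∑ γ, (Υ : ℝ) ^ q * commSum (List.ofFn H) q ⁅H γ, B⁆ := by
          gcongr with γ; exact ih _
      _ = (Υ : ℝ) ^ (q + 1) * commSum (List.ofFn H) (q + 1) B := by
          simp only [commSum, List.map_ofFn, List.sum_ofFn, Function.comp_def, ← mul_sum, pow_succ']
          ring

/-- Passage from nested commutators that are built up by adding an outermost letter to those that
are built up by adding an innermost one. -/
theorem sum_commSum_nestedCommutator (H : Fin Γ → Op d) (p r : ℕ) :
    ∑ γ : Fin (p + 1) → Fin Γ, commSum (List.ofFn H) r (nestedCommutator p fun i => H (γ i)) =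
      alphaComm (p + r) H := by
  induction r generalizing p with
  | zero => rfl
  | succ r ih =>
    rw [← add_assoc, add_right_comm, ← ih (p + 1),
      ← Equiv.sum_comp (Fin.snocEquiv fun _ : Fin (p + 2) => Fin Γ), Fintype.sum_prod_type_right]
    simp only [commSum, List.map_ofFn, List.sum_ofFn, Function.comp_def, nestedCommutator,
      Fin.snocEquiv_apply, Fin.snoc_last, Fin.snoc_castSucc]

theorem sum_commSum_eq_alphaComm (H : Fin Γ → Op d) (p : ℕ) :
    ∑ γ, commSum (List.ofFn H) p (H γ) = alphaComm p H := by
  rw [← zero_add p, ← sum_commSum_nestedCommutator H 0 p, zero_add,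
    ← Equiv.sum_comp (Equiv.funUnique (Fin 1) (Fin Γ))]
  rfl

theorem sum_map_commSum_generators_le {a : Fin Υ → Fin Γ → ℝ} (ha : ∀ υ γ, |a υ γ| ≤ 1)
    (π : Fin Υ → Equiv.Perm (Fin Γ)) (H : Fin Γ → Op d) (p : ℕ) :
    ((generators a π H).map (commSum (generators a π H) p)).sum ≤
      (Υ : ℝ) ^ (p + 1) * alphaComm p H :=
  calc _ ≤ Υ * ∑ γ, commSum (generators a π H) p (H γ) :=
        sum_map_generators_le ha π H fun _ X hr => commSum_smul_le _ p hr X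
    _ ≤ Υ * ∑ γ, (Υ : ℝ) ^ p * commSum (List.ofFn H) p (H γ) := by
        gcongr with γ; exact commSum_generators_le ha π H p _
    _ = (Υ : ℝ) ^ (p + 1) * alphaComm p H := by
        rw [← mul_sum, sum_commSum_eq_alphaComm, pow_succ']
        ring

theorem alphaComm_nonneg (p : ℕ) (H : Fin Γ → Op d) : 0 ≤ alphaComm p H :=
  sum_nonneg fun _ _ => norm_nonneg _

/-- The additive error bound with an abstract growth function: `m = ‖·‖` gives the general
estimate, `m = 0` the anti-Hermitian one. -/
theorem norm_additiveError_le [Nonempty (Fin d)] {a : Fin Υ → Fin Γ → ℝ}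
    (ha : ∀ υ γ, |a υ γ| ≤ 1) {π : Fin Υ → Equiv.Perm (Fin Γ)} {H : Fin Γ → Op d} {p : ℕ}
    (hp : IsOfOrder p a π H) {m : Op d → ℝ} {M : ℝ}
    (hm : ∀ υ γ s, 0 ≤ s →
      ‖NormedSpace.exp (s • a υ γ • H (π υ γ))‖ ≤ Real.exp (s * m (a υ γ • H (π υ γ))))
    (hH : ∀ s, 0 ≤ s → ‖NormedSpace.exp (s • total H)‖ ≤ Real.exp (s * m (total H)))
    (hHM : m (total H) ≤ M) (hLM : ((generators a π H).map m).sum ≤ M) {t : ℝ} (ht : 0 ≤ t) :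
    ‖additiveError a π H t‖ ≤
      ((Υ : ℝ) ^ (p + 1) + 1) * (alphaComm p H * t ^ (p + 1) * Real.exp (t * M)) := by
  have hO : (fun t : ℝ => orderedExp (generators a π H) t - NormedSpace.exp (t • total H))
      =O[𝓝 0] fun t : ℝ => t ^ (p + 1) := by
    simpa only [IsOfOrder, productFormula_eq_orderedExp, evolution] using hp
  have h := norm_orderedExp_sub_exp_le
    (forall_mem_generators (P := fun A => ∀ s : ℝ, 0 ≤ s → _) hm) hH hHM hLM hO ht
  rw [additiveError, productFormula_eq_orderedExp, evolution]
  have h0 : (if p = 0 then ‖total H‖ else 0) ≤ alphaComm p H := by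
    split_ifs with hp0
    · subst hp0
      rw [← sum_commSum_eq_alphaComm]
      exact norm_sum_le _ _
    · exact alphaComm_nonneg p H
  calc _ ≤ _ := h
    _ ≤ ((Υ : ℝ) ^ (p + 1) * alphaComm p H + alphaComm p H) * t ^ (p + 1) * Real.exp (t * M) := by
        gcongr
        exact sum_map_commSum_generators_le ha π H p
    _ = _ := by ring

theorem multiplicativeError_eq_mul (a : Fin Υ → Fin Γ → ℝ) (π : Fin Υ → Equiv.Perm (Fin Γ))
    (H : Fin Γ → Op d) (t : ℝ) :
    multiplicativeError a π H t = evolution H (-t) * additiveError a π H t := by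
  have h : evolution H (-t) * evolution H t = 1 := by
    unfold evolution
    rw [← Matrix.exp_add_of_commute, neg_smul, neg_add_cancel, NormedSpace.exp_zero]
    exact ((Commute.refl (total H)).smul_left (-t)).smul_right t
  rw [multiplicativeError, additiveError, mul_sub, h]

theorem norm_exp_eq_one_of_conjTranspose_eq_neg [Nonempty (Fin d)] {A : Op d} (hA : Aᴴ = -A) :
    ‖NormedSpace.exp A‖ = 1 := by
  have h : star (NormedSpace.exp A) * NormedSpace.exp A = 1 := by
    rw [Matrix.star_eq_conjTranspose, ← Matrix.exp_conjTranspose, hA,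
      ← Matrix.exp_add_of_commute _ _ (Commute.refl A).neg_left, neg_add_cancel,
      NormedSpace.exp_zero]
  have h2 := CStarRing.norm_star_mul_self (x := NormedSpace.exp A)
  rw [h, CStarRing.norm_one] at h2
  nlinarith [norm_nonneg (NormedSpace.exp A)]

theorem norm_total_le (H : Fin Γ → Op d) : ‖total H‖ ≤ ∑ γ, ‖H γ‖ := norm_sum_le _ _

theorem conjTranspose_real_smul {A : Op d} (hA : Aᴴ = -A) (r : ℝ) : (r • A)ᴴ = -(r • A) := by
  rw [Matrix.conjTranspose_smul, hA, star_trivial, smul_neg]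

end Trotter

end

/-! ### The error bounds -/

theorem theorem3p4 (p Υ : ℕ) (hΥ : 1 ≤ Υ) :
    ∃ C : ℝ, 0 < C ∧
      ∀ (d Γ : ℕ) (H : Fin Γ → Matrix (Fin d) (Fin d) ℂ)
        (a : Fin Υ → Fin Γ → ℝ) (π : Fin Υ → Equiv.Perm (Fin Γ)),
        (∀ υ γ, |a υ γ| ≤ 1) →
        Trotter.IsOfOrder p a π H →
        (∀ t : ℝ, 0 ≤ t →
          ‖Trotter.additiveError a π H t‖ ≤
              C * (Trotter.alphaComm p H * t ^ (p + 1) *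
                Real.exp (2 * t * (Υ : ℝ) * ∑ γ, ‖H γ‖)) ∧
          ‖Trotter.multiplicativeError a π H t‖ ≤
              C * (Trotter.alphaComm p H * t ^ (p + 1) *
                Real.exp (2 * t * (Υ : ℝ) * ∑ γ, ‖H γ‖))) ∧
        ((∀ γ, (H γ)ᴴ = -H γ) →
          ∀ t : ℝ, 0 ≤ t →
            ‖Trotter.additiveError a π H t‖ ≤
                C * (Trotter.alphaComm p H * t ^ (p + 1)) ∧
            ‖Trotter.multiplicativeError a π H t‖ ≤
                C * (Trotter.alphaComm p H * t ^ (p + 1))) := by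
  refine ⟨(Υ : ℝ) ^ (p + 1) + 1, by positivity, fun d Γ H a π ha hp => ?_⟩
  have hα := Trotter.alphaComm_nonneg p H
  rcases isEmpty_or_nonempty (Fin d) with hd | hd
  · -- in dimension zero every matrix vanishes, and `‖1‖ = 0`
    have h0 : ∀ X : Trotter.Op d, ‖X‖ = 0 := fun X => by rw [Subsingleton.elim X 0, norm_zero]
    refine ⟨fun t ht => ?_, fun _ t ht => ?_⟩ <;> simp only [h0] <;> constructor <;> positivity
  have hΥ' : (1 : ℝ) ≤ Υ := by exact_mod_cast hΥ
  refine ⟨fun t ht => ?_, fun hH t ht => ?_⟩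
  · set Λ := ∑ γ, ‖H γ‖
    have hΛ0 : 0 ≤ Λ := Finset.sum_nonneg fun γ _ => norm_nonneg _
    have hΛ' : Λ ≤ Υ * Λ := le_mul_of_one_le_left hΛ0 hΥ'
    have hexp : ∀ (X : Trotter.Op d) (s : ℝ), 0 ≤ s →
        ‖NormedSpace.exp (s • X)‖ ≤ Real.exp (s * ‖X‖) := fun X s hs => by
      simpa [norm_smul, abs_of_nonneg hs] using Trotter.norm_exp_le_exp_norm (s • X)
    have hA := Trotter.norm_additiveError_le ha hp (m := fun X => ‖X‖) (M := Υ * Λ)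
      (fun υ γ s hs => hexp _ s hs) (fun s hs => hexp _ s hs)
      ((Trotter.norm_total_le H).trans hΛ')
      (Trotter.sum_map_generators_le ha π H fun r X hr => by
        rw [norm_smul]; exact mul_le_of_le_one_left (norm_nonneg _) hr) ht
    have hE : ‖Trotter.evolution H (-t)‖ ≤ Real.exp (t * (Υ * Λ)) := by
      refine (Trotter.norm_exp_le_exp_norm _).trans (Real.exp_le_exp.2 ?_)
      rw [norm_smul, norm_neg, Real.norm_of_nonneg ht]
      exact mul_le_mul_of_nonneg_left ((Trotter.norm_total_le H).trans hΛ') ht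
    have h2 : Real.exp (2 * t * Υ * Λ) = Real.exp (t * (Υ * Λ)) * Real.exp (t * (Υ * Λ)) := by
      rw [← Real.exp_add]; congr 1; ring
    constructor
    · have hle : Real.exp (t * (Υ * Λ)) ≤ Real.exp (2 * t * Υ * Λ) := by
        rw [h2]
        exact le_mul_of_one_le_left (Real.exp_pos _).le (Real.one_le_exp (by positivity))
      exact hA.trans (by gcongr)
    · rw [Trotter.multiplicativeError_eq_mul, h2]
      exact (norm_mul_le_of_le hE hA).trans_eq (by ring)
  · have hanti : ∀ (X : Trotter.Op d), Xᴴ = -X → ∀ s : ℝ, ‖NormedSpace.exp (s • X)‖ = 1 :=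
      fun X hX s => Trotter.norm_exp_eq_one_of_conjTranspose_eq_neg
        (Trotter.conjTranspose_real_smul hX s)
    have htot : (Trotter.total H)ᴴ = -Trotter.total H := by
      simp [Trotter.total, Matrix.conjTranspose_sum, hH]
    have hA : ‖Trotter.additiveError a π H t‖ ≤
        ((Υ : ℝ) ^ (p + 1) + 1) * (Trotter.alphaComm p H * t ^ (p + 1)) := by
      simpa using Trotter.norm_additiveError_le ha hp (m := fun _ => 0) (M := 0)
        (fun υ γ s _ => by
          simpa using (hanti _ (Trotter.conjTranspose_real_smul (hH (π υ γ)) (a υ γ)) s).le)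
        (fun s _ => by simpa using (hanti _ htot s).le) le_rfl (by simp) ht
    refine ⟨hA, ?_⟩
    rw [Trotter.multiplicativeError_eq_mul]
    have hE : ‖Trotter.evolution H (-t)‖ ≤ 1 := (hanti _ htot (-t)).le
    simpa using norm_mul_le_of_le hE hA
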